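/- Let $0<\alpha\le 1$ and let $Z=(Z(s))_{s\ge 0}$ be a $Q_\alpha$-Markov chain starting from $Z(0)=1$, i.e. a continuous-time Markov chain on $\mathbb{N}_0=\{0,1,2,\ldots\}$ with càdlàg paths whose Q-matrix $Q_\alpha$ has as its only non-zero off-diagonal entries $q_\alpha(m,m+1)=m-\alpha$ and $q_\alpha(m,m-1)=m$ for $m\ge 1$ (rows sum to zero, so that $0$ is absorbing). Let $\zeta=\inf\{s\ge 0\colon Z(s)=0\}$, with $\inf\varnothing=\infty$, be its absorption time. Then $\zeta$ is almost surely finite, and for all $\lambda>0$, $$\mathbb{E}_1\big(e^{-\lambda\zeta}\big)=1-\frac{\lambda}{\alpha}+\frac{\lambda^{1+\alpha}}{\alpha e^{\lambda}\,\Gamma(1+\alpha,\lambda)},\qquad\text{where}\quad \Gamma(a,z)=\int_z^\infty e^{-t}t^{a-1}\,dt\quad(z>0,\ a\in\mathbb{R})$$ is the incomplete Gamma function. In particular, if $\alpha=1$, then $\zeta$ is exponentially distributed with rate $1$. Moreover, $\mathbb{E}_1(\zeta)=1/\alpha$ for all $0<\alpha\le 1$. -/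

import Mathlib

open MeasureTheory ProbabilityTheory Filter Topology
open scoped NNReal ENNReal

namespace TableSize

/-- The Q-matrix `Q_α` on `ℕ = {0, 1, 2, …}`: from each state `m ≥ 1` the chain jumps to `m + 1` at
rate `m - α` and to `m - 1` at rate `m`; all other off-diagonal entries vanish, and the rows sum to
zero (in particular `0` is absorbing). -/
def qMatrix (α : ℝ) : Matrix ℕ ℕ ℝ := fun m j =>
  if m = 0 then 0
  else if j = m + 1 then (m : ℝ) - α
  else if j + 1 = m then (m : ℝ)
  else if j = m then -(2 * (m : ℝ) - α)
  else 0

/-- A (stochastic) transition function on `ℕ`, indexed by times `t ≥ 0`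
(the values at negative times are irrelevant). -/
structure IsTransitionFunction (p : ℝ → Matrix ℕ ℕ ℝ) : Prop where
  nonneg : ∀ t, 0 ≤ t → ∀ i j, 0 ≤ p t i j
  row_sum : ∀ t, 0 ≤ t → ∀ i, HasSum (fun j => p t i j) 1
  zero : p 0 = 1
  chapman_kolmogorov : ∀ s t, 0 ≤ s → 0 ≤ t → ∀ i j,
    HasSum (fun k => p s i k * p t k j) (p (s + t) i j)

/-- `Q` is the matrix of infinitesimal rates of `p`, that is, the entrywise right derivative of `p`
at time `0`. -/
def HasQMatrix (p : ℝ → Matrix ℕ ℕ ℝ) (Q : Matrix ℕ ℕ ℝ) : Prop :=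
  ∀ i j, HasDerivWithinAt (fun t => p t i j) (Q i j) (Set.Ici 0) 0

/-- The process `Z` is, under `μ`, a continuous-time Markov chain on `ℕ` with Q-matrix `Q`, with
càdlàg paths, starting from `x₀`: it is time-homogeneous Markov with respect to a transition
function whose Q-matrix is `Q`. -/
structure IsMarkovChain {Ω : Type*} [MeasurableSpace Ω] (Q : Matrix ℕ ℕ ℝ) (x₀ : ℕ)
    (Z : ℝ≥0 → Ω → ℕ) (μ : Measure Ω) : Prop where
  measurable : ∀ t, Measurable (Z t)
  right_continuous : ∀ ω t, ContinuousWithinAt (fun s => Z s ω) (Set.Ici t) t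
  left_limits : ∀ ω t, ∃ l, Tendsto (fun s => Z s ω) (𝓝[<] t) (𝓝 l)
  start : ∀ᵐ ω ∂μ, Z 0 ω = x₀
  markov : ∃ p : ℝ → Matrix ℕ ℕ ℝ, IsTransitionFunction p ∧ HasQMatrix p Q ∧
    ∀ (n : ℕ) (t : Fin (n + 1) → ℝ≥0), Monotone t → ∀ x : Fin (n + 1) → ℕ,
      μ.real {ω | ∀ k, Z (t k) ω = x k} =
        μ.real {ω | Z (t 0) ω = x 0} *
          ∏ k : Fin n, p ((t k.succ : ℝ) - (t k.castSucc : ℝ)) (x k.castSucc) (x k.succ)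

/-- The hitting time `inf {s ≥ 0 : Z s = 0}`, with `inf ∅ = ∞`. -/
noncomputable def hittingTimeZero {Ω : Type*} (Z : ℝ≥0 → Ω → ℕ) (ω : Ω) : ℝ≥0∞ :=
  ⨅ (s : ℝ≥0) (_ : Z s ω = 0), (s : ℝ≥0∞)

/-- The (upper) incomplete Gamma function `Γ(a, z) = ∫_z^∞ e^{-t} t^{a-1} dt`, for `z > 0`. -/
noncomputable def incompleteGamma (a z : ℝ) : ℝ :=
  ∫ t in Set.Ioi z, Real.exp (-t) * t ^ (a - 1)

end TableSize

/-! Since `0` is absorbing and paths are right-continuous, `ζ ≤ t` and `Z t = 0` agree almost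
surely, so the distribution function of `ζ` is `p t 1 0`. Everything is then read off the transition
function.

The Kolmogorov backward equation, Laplace transformed in time, shows that `φ m = l ∫ e^{-lt} p t m 0
dt` is a bounded solution of `(l - Q_α) φ = 0` on the positive states with `φ 0 = 1`. Such a
solution has a unique value at `1` (`apply_one_nonpos_of_recurrence`): a difference `d` with `d 0 =
0 < d 1` has increments at least of order `1 / m`, so it is unbounded by divergence of the harmonic
series.

An explicit bounded solution is, up to normalisation, `∫ e^{-lx} (1 + x)^α (x / (1 + x))^m dx`:
differentiating the integrand in `x` reproduces the rates of `Q_α`, and integrating the derivative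
gives the recurrence. The boundary term at `m = 0` expresses the value at `1` through the value at
`0`, which is an incomplete Gamma function.

Letting `l → 0` yields almost sure finiteness and the mean. For `α = 1` the rate from `1` to `2`
vanishes and the backward equation is solved directly. -/

namespace TableSize

/-! ### Transition functions: continuity, backward equation and its Laplace transform -/

/-- A real function squeezed between two functions which have the same one-sided derivative and the
same value at a point has that one-sided derivative as well. -/
theorem hasDerivWithinAt_Ici_of_squeeze {f l u : ℝ → ℝ} {a d : ℝ}
    (hl : HasDerivWithinAt l d (Set.Ici a) a) (hu : HasDerivWithinAt u d (Set.Ici a) a)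
    (hla : l a = f a) (hua : u a = f a)
    (hlf : ∀ x, a < x → l x ≤ f x) (hfu : ∀ x, a < x → f x ≤ u x) :
    HasDerivWithinAt f d (Set.Ici a) a := by
  rw [hasDerivWithinAt_iff_tendsto_slope, Set.Ici_sdiff_left] at *
  refine tendsto_of_tendsto_of_tendsto_of_le_of_le' hl hu ?_ ?_
  · filter_upwards [self_mem_nhdsWithin] with x hx
    have hx' : 0 < x - a := sub_pos.2 hx
    rw [slope_def_field, slope_def_field, hla]
    have := hlf x hx
    gcongr
  · filter_upwards [self_mem_nhdsWithin] with x hx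
    have hx' : 0 < x - a := sub_pos.2 hx
    rw [slope_def_field, slope_def_field, hua]
    have := hfu x hx
    gcongr

namespace IsTransitionFunction

variable {p : ℝ → Matrix ℕ ℕ ℝ} {Q : Matrix ℕ ℕ ℝ}

theorem le_one (hp : IsTransitionFunction p) {t : ℝ} (ht : 0 ≤ t) (i j : ℕ) : p t i j ≤ 1 :=
  le_hasSum (hp.row_sum t ht i) j fun k _ => hp.nonneg t ht i k

theorem sum_mul_le (hp : IsTransitionFunction p) {s t : ℝ} (hs : 0 ≤ s) (ht : 0 ≤ t) (i j : ℕ)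
    (S : Finset ℕ) : ∑ k ∈ S, p s i k * p t k j ≤ p (s + t) i j :=
  sum_le_hasSum S (fun k _ => mul_nonneg (hp.nonneg s hs i k) (hp.nonneg t ht k j))
    (hp.chapman_kolmogorov s t hs ht i j)

/-- Chapman–Kolmogorov applied to the complement of `j`. Together with `sum_mul_le` it bounds `p (s
+ t) i j` from both sides by finite sums, so no interchange of derivative and infinite sum is
needed. -/
theorem le_one_sub_sum_mul (hp : IsTransitionFunction p) {s t : ℝ} (hs : 0 ≤ s) (ht : 0 ≤ t)
    (i j : ℕ) (S : Finset ℕ) :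
    p (s + t) i j ≤ 1 - ∑ k ∈ S, p s i k * (1 - p t k j) := by
  have h : HasSum (fun k => p s i k * (1 - p t k j)) (1 - p (s + t) i j) := by
    simpa [mul_sub] using (hp.row_sum s hs i).sub (hp.chapman_kolmogorov s t hs ht i j)
  have := sum_le_hasSum S
    (fun k _ => mul_nonneg (hp.nonneg s hs i k) (sub_nonneg.2 (hp.le_one ht k j))) h
  linarith

/-- Both finite-sum bounds with the single intermediate state `i`. The estimate is uniform in `t`,
so continuity at time `0` spreads to all times. -/
theorem abs_add_sub_le (hp : IsTransitionFunction p) {s t : ℝ} (hs : 0 ≤ s) (ht : 0 ≤ t)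
    (i j : ℕ) : |p (s + t) i j - p t i j| ≤ 1 - p s i i := by
  have h1 := hp.sum_mul_le hs ht i j {i}
  have h2 := hp.le_one_sub_sum_mul hs ht i j {i}
  have h3 := hp.le_one hs i i
  have h4 := hp.le_one ht i j
  have h5 := hp.nonneg t ht i j
  simp only [Finset.sum_singleton] at h1 h2
  rw [abs_le]
  constructor <;> nlinarith

theorem continuousOn (hp : IsTransitionFunction p) (hQ : HasQMatrix p Q) (i j : ℕ) :
    ContinuousOn (fun t => p t i j) (Set.Ici 0) := by
  intro t ht
  have h0 : Tendsto (fun s => 1 - p |s - t| i i) (𝓝[Set.Ici 0] t) (𝓝 0) := by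
    have h1 : Tendsto (fun s => |s - t|) (𝓝[Set.Ici 0] t) (𝓝[Set.Ici 0] 0) := by
      refine tendsto_nhdsWithin_iff.2 ⟨?_, Eventually.of_forall fun s => Set.mem_Ici.2 (abs_nonneg _)⟩
      have : Continuous fun s : ℝ => |s - t| := by fun_prop
      simpa using (this.tendsto t).mono_left nhdsWithin_le_nhds
    have h2 : Tendsto (fun s => p s i i) (𝓝[Set.Ici 0] 0) (𝓝 (p 0 i i)) :=
      (hQ i i).continuousWithinAt
    simpa [hp.zero] using (h2.comp h1).const_sub 1
  refine tendsto_iff_dist_tendsto_zero.2 (squeeze_zero' (Eventually.of_forall fun _ => dist_nonneg)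
    ?_ h0)
  filter_upwards [self_mem_nhdsWithin] with s hs
  rw [Real.dist_eq]
  rcases le_total t s with h | h
  · simpa [abs_of_nonneg (sub_nonneg.2 h)] using hp.abs_add_sub_le (sub_nonneg.2 h) ht i j
  · rw [abs_sub_comm, abs_sub_comm s t]
    simpa [abs_of_nonneg (sub_nonneg.2 h)] using hp.abs_add_sub_le (sub_nonneg.2 h) hs i j

/-- The Kolmogorov backward equation, for a state `i` with finitely many possible targets and
conservative row. -/
theorem hasDerivWithinAt (hp : IsTransitionFunction p) (hQ : HasQMatrix p Q) {i : ℕ}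
    {S : Finset ℕ} (hi : i ∈ S) (hS : ∑ k ∈ S, Q i k = 0) (j : ℕ) {t : ℝ} (ht : 0 ≤ t) :
    HasDerivWithinAt (fun s => p s i j) (∑ k ∈ S, Q i k * p t k j) (Set.Ici t) t := by
  have hd : ∀ k, HasDerivWithinAt (fun s => p (s - t) i k) (Q i k) (Set.Ici t) t := by
    intro k
    have h1 : HasDerivWithinAt (fun s : ℝ => s - t) 1 (Set.Ici t) t :=
      (hasDerivWithinAt_id t _).sub_const t
    have h2 : HasDerivWithinAt (fun s => p s i k) (Q i k) (Set.Ici 0) (t - t) := by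
      simpa using hQ i k
    simpa [Function.comp_def] using
      h2.comp (h := fun s => s - t) t h1 (fun s (hs : t ≤ s) => Set.mem_Ici.2 (sub_nonneg.2 hs))
  -- The two bounds agree at `s = t` because `i ∈ S`, and have the same right derivative because the
  -- row of `Q` sums to zero over `S`.
  refine hasDerivWithinAt_Ici_of_squeeze (l := fun s => ∑ k ∈ S, p (s - t) i k * p t k j)
    (u := fun s => 1 - ∑ k ∈ S, p (s - t) i k * (1 - p t k j)) ?_ ?_ ?_ ?_ ?_ ?_
  · exact HasDerivWithinAt.fun_sum fun k _ => (hd k).mul_const _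
  · have h := (HasDerivWithinAt.fun_sum fun k (_ : k ∈ S) =>
      (hd k).mul_const (1 - p t k j)).const_sub 1
    refine h.congr_deriv ?_
    simp only [mul_sub, mul_one, Finset.sum_sub_distrib, hS]
    ring
  · simp [hp.zero, Matrix.one_apply, hi]
  · simp [hp.zero, Matrix.one_apply, hi]
  · intro s hs
    simpa using hp.sum_mul_le (sub_nonneg.2 hs.le) ht i j S
  · intro s hs
    simpa using hp.le_one_sub_sum_mul (sub_nonneg.2 hs.le) ht i j S

theorem integrableOn_exp_mul (hp : IsTransitionFunction p) (hQ : HasQMatrix p Q) {l : ℝ}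
    (hl : 0 < l) (i j : ℕ) :
    IntegrableOn (fun t => Real.exp (-l * t) * p t i j) (Set.Ioi 0) := by
  refine Integrable.mono' (integrableOn_exp_mul_Ioi (neg_lt_zero.2 hl) 0) ?_ ?_
  · refine ContinuousOn.aestronglyMeasurable ?_ measurableSet_Ioi
    exact (Continuous.continuousOn (by fun_prop)).mul
      ((hp.continuousOn hQ i j).mono Set.Ioi_subset_Ici_self)
  · filter_upwards [ae_restrict_mem measurableSet_Ioi] with t ht
    rw [Real.norm_eq_abs, abs_mul, abs_of_pos (Real.exp_pos _),
      abs_of_nonneg (hp.nonneg t (le_of_lt ht) i j)]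
    exact mul_le_of_le_one_right (Real.exp_pos _).le (hp.le_one (le_of_lt ht) i j)

/-- The Laplace transform of the Kolmogorov backward equation. -/
theorem laplace_backward (hp : IsTransitionFunction p) (hQ : HasQMatrix p Q) {i : ℕ}
    {S : Finset ℕ} (hi : i ∈ S) (hS : ∑ k ∈ S, Q i k = 0) (j : ℕ) {l : ℝ} (hl : 0 < l) :
    l * ∫ t in Set.Ioi 0, Real.exp (-l * t) * p t i j =
      p 0 i j + ∑ k ∈ S, Q i k * ∫ t in Set.Ioi 0, Real.exp (-l * t) * p t k j := by
  set g : ℝ → ℝ := fun t =>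
    -l * (Real.exp (-l * t) * p t i j) + ∑ k ∈ S, Q i k * (Real.exp (-l * t) * p t k j) with hg
  have hint : ∀ k, IntegrableOn (fun t => Real.exp (-l * t) * p t k j) (Set.Ioi 0) :=
    fun k => hp.integrableOn_exp_mul hQ hl k j
  have hint1 : IntegrableOn (fun t => -l * (Real.exp (-l * t) * p t i j)) (Set.Ioi 0) :=
    (hint i).const_mul _
  have hint2 : IntegrableOn (fun t => ∑ k ∈ S, Q i k * (Real.exp (-l * t) * p t k j))
      (Set.Ioi 0) := integrable_finsetSum _ fun k _ => (hint k).const_mul _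
  have hgint : IntegrableOn g (Set.Ioi 0) := hint1.add hint2
  have hcont : ContinuousOn (fun t => Real.exp (-l * t) * p t i j) (Set.Ici 0) :=
    (Continuous.continuousOn (by fun_prop)).mul (hp.continuousOn hQ i j)
  have hftc : ∀ T, 0 ≤ T → ∫ t in (0 : ℝ)..T, g t = Real.exp (-l * T) * p T i j - p 0 i j := by
    intro T hT
    -- A right derivative, which is all the backward equation provides here, suffices for this form
    -- of the fundamental theorem.
    have := intervalIntegral.integral_eq_sub_of_hasDeriv_right (a := 0) (b := T)
      (f := fun t => Real.exp (-l * t) * p t i j) (f' := g) ?_ ?_ ?_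
    · simpa using this
    · rw [Set.uIcc_of_le hT]
      exact hcont.mono Set.Icc_subset_Ici_self
    · intro t ht
      rw [min_eq_left hT, max_eq_right hT] at ht
      have h1 := (hp.hasDerivWithinAt hQ hi hS j ht.1.le).mono Set.Ioi_subset_Ici_self
      have h2 : HasDerivAt (fun t => Real.exp (-l * t)) (Real.exp (-l * t) * (-l)) t := by
        simpa using ((hasDerivAt_id t).const_mul (-l)).exp
      refine (h2.hasDerivWithinAt.mul h1).congr_deriv ?_
      simp only [hg, Finset.mul_sum]
      congr 1
      · ring
      · exact Finset.sum_congr rfl fun k _ => by ring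
    · rw [intervalIntegrable_iff_integrableOn_Ioc_of_le hT]
      exact hgint.mono_set Set.Ioc_subset_Ioi_self
  have hlim1 := intervalIntegral_tendsto_integral_Ioi 0 hgint tendsto_id
  have hlim2 : Tendsto (fun T => ∫ t in (0 : ℝ)..T, g t) atTop (𝓝 (0 - p 0 i j)) := by
    have h0 : Tendsto (fun T => Real.exp (-l * T)) atTop (𝓝 0) :=
      Real.tendsto_exp_atBot.comp (tendsto_id.const_mul_atTop_of_neg (neg_lt_zero.2 hl))
    have h1 : Tendsto (fun T => Real.exp (-l * T) * p T i j) atTop (𝓝 0) := by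
      refine squeeze_zero' ?_ ?_ h0
      · filter_upwards [eventually_ge_atTop 0] with T hT
        exact mul_nonneg (Real.exp_pos _).le (hp.nonneg T hT i j)
      · filter_upwards [eventually_ge_atTop 0] with T hT
        exact mul_le_of_le_one_right (Real.exp_pos _).le (hp.le_one hT i j)
    refine (h1.sub_const _).congr' ?_
    filter_upwards [eventually_ge_atTop 0] with T hT
    rw [hftc T hT]
  have heq := tendsto_nhds_unique hlim1 hlim2
  rw [hg, integral_add hint1 hint2, integral_const_mul,
    integral_finsetSum _ fun k _ => (hint k).const_mul _] at heq
  simp only [integral_const_mul] at heq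
  linarith

/-- A state with vanishing row in the Q-matrix is absorbing. -/
theorem apply_self_eq_one (hp : IsTransitionFunction p) (hQ : HasQMatrix p Q) {i : ℕ}
    (hi : Q i i = 0) {t : ℝ} (ht : 0 ≤ t) : p t i i = 1 := by
  have h := constant_of_has_deriv_right_zero (f := fun s => p s i i) (a := 0) (b := t)
    ((hp.continuousOn hQ i i).mono Set.Icc_subset_Ici_self) (fun s hs => by
      simpa [hi] using hp.hasDerivWithinAt hQ (Finset.mem_singleton_self i) (by simpa using hi) i
        hs.1) t ⟨ht, le_rfl⟩
  simpa [hp.zero] using h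

end IsTransitionFunction

/-! ### Bounded solutions of the resolvent recurrence: uniqueness and an integral formula -/

/-- A bounded solution of `(l - Q_α) d = 0` on `{1, 2, …}` with `d 0 = 0` is not positive at `1`. -/
theorem apply_one_nonpos_of_recurrence {α l : ℝ} (hα₀ : 0 < α) (hα₁ : α ≤ 1) (hl : 0 < l)
    {d : ℕ → ℝ} {C : ℝ} (hC : ∀ m, d m ≤ C) (h0 : d 0 = 0)
    (hd : ∀ m : ℕ, l * d (m + 1) = (m + 1 - α) * d (m + 2) + (m + 1) * d m -
      (2 * (m + 1) - α) * d (m + 1)) : d 1 ≤ 0 := by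
  by_contra! h1
  -- Discrete maximum principle: the recurrence writes the next increment, times its rate, as a
  -- positive multiple of `d (m + 1)` plus a nonnegative multiple of the previous increment, so `d`
  -- never decreases. If `α = 1` and `m = 0` the rate is zero and the recurrence itself is
  -- contradictory.
  have key : ∀ m : ℕ, d 1 ≤ d (m + 1) ∧ d m ≤ d (m + 1) := by
    intro m
    induction m with
    | zero => exact ⟨le_rfl, by rw [h0]; exact h1.le⟩
    | succ m ih =>
      have h2 : (m + 1 - α) * (d (m + 2) - d (m + 1)) =
          l * d (m + 1) + (m + 1) * (d (m + 1) - d m) := by linarith [hd m]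
      have h3 : 0 < l * d (m + 1) := mul_pos hl (h1.trans_le ih.1)
      have h4 : 0 ≤ ((m : ℝ) + 1) * (d (m + 1) - d m) :=
        mul_nonneg (by positivity) (sub_nonneg.2 ih.2)
      have h5 : 0 ≤ (m : ℝ) + 1 - α := by
        have : (0 : ℝ) ≤ m := m.cast_nonneg
        linarith
      have h6 : 0 < d (m + 2) - d (m + 1) := by
        by_contra! h
        have := mul_nonpos_of_nonneg_of_nonpos h5 h
        linarith
      exact ⟨by linarith [ih.1], by linarith⟩
  -- Dropping the previous increment and enlarging the rate `m + 1 - α` to `m + 1` leaves a harmonic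
  -- lower bound.
  have hstep : ∀ m : ℕ, l * d 1 * (1 / ((m : ℝ) + 1)) ≤ d (m + 2) - d (m + 1) := by
    intro m
    have hm : (0 : ℝ) < m + 1 := by positivity
    have h2 : (m + 1 - α) * (d (m + 2) - d (m + 1)) =
        l * d (m + 1) + (m + 1) * (d (m + 1) - d m) := by linarith [hd m]
    have h3 : l * d 1 ≤ l * d (m + 1) := mul_le_mul_of_nonneg_left (key m).1 hl.le
    have h4 : 0 ≤ ((m : ℝ) + 1) * (d (m + 1) - d m) :=
      mul_nonneg hm.le (sub_nonneg.2 (key m).2)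
    have h5 : 0 ≤ α * (d (m + 2) - d (m + 1)) :=
      mul_nonneg hα₀.le (sub_nonneg.2 (key (m + 1)).2)
    rw [mul_one_div, div_le_iff₀ hm]
    linarith
  have hsum : ∀ n : ℕ, l * d 1 * ∑ i ∈ Finset.range n, 1 / ((i : ℝ) + 1) ≤ C - d 1 := by
    intro n
    rw [Finset.mul_sum]
    calc _ ≤ ∑ i ∈ Finset.range n, (d (i + 1 + 1) - d (i + 1)) :=
          Finset.sum_le_sum fun i _ => hstep i
      _ = d (n + 1) - d 1 := by rw [Finset.sum_range_sub (fun i => d (i + 1))]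
      _ ≤ C - d 1 := by linarith [hC (n + 1)]
  have htend := Real.tendsto_sum_range_one_div_nat_succ_atTop.const_mul_atTop (mul_pos hl h1)
  obtain ⟨n, hn⟩ := (htend.eventually_gt_atTop (C - d 1)).exists
  exact absurd (hsum n) (not_le.2 hn)

/-- Up to a multiplicative constant, the bounded solution of `(l - Q_α) ψ = 0` on `{1, 2, …}`. -/
noncomputable def laplaceSolution (α l : ℝ) (m : ℕ) : ℝ :=
  ∫ x in Set.Ioi (0 : ℝ), Real.exp (-l * x) * (1 + x) ^ α * (x / (1 + x)) ^ m

/-- As `α ≤ 1`, the power grows at most linearly, which half of the exponential decay absorbs. This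
gives a dominating function independent of `m`. -/
theorem exp_mul_rpow_le {α l x : ℝ} (hα₁ : α ≤ 1) (hl : 0 < l) (hx : 0 ≤ x) :
    Real.exp (-l * x) * (1 + x) ^ α ≤ (1 + 2 / l) * Real.exp (-(l / 2) * x) := by
  have h1 : (1 + x) ^ α ≤ 1 + x := by
    simpa using Real.rpow_le_rpow_of_exponent_le (by linarith : 1 ≤ 1 + x) hα₁
  have h2 : 1 + x ≤ (1 + 2 / l) * Real.exp (l / 2 * x) := by
    have h3 := Real.add_one_le_exp (l / 2 * x)
    have h4 : 1 ≤ Real.exp (l / 2 * x) := Real.one_le_exp (by positivity)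
    have h5 : x ≤ 2 / l * Real.exp (l / 2 * x) := by
      rw [div_mul_eq_mul_div, le_div_iff₀ hl]
      linarith
    linarith
  calc Real.exp (-l * x) * (1 + x) ^ α
      ≤ Real.exp (-l * x) * ((1 + 2 / l) * Real.exp (l / 2 * x)) := by
        gcongr
        exact h1.trans h2
    _ = (1 + 2 / l) * (Real.exp (-l * x) * Real.exp (l / 2 * x)) := by ring
    _ = _ := by
      rw [← Real.exp_add]
      ring_nf

theorem div_one_add_pow_mem {x : ℝ} (hx : 0 ≤ x) (m : ℕ) :
    0 ≤ (x / (1 + x)) ^ m ∧ (x / (1 + x)) ^ m ≤ 1 := by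
  have h : 0 ≤ x / (1 + x) := by positivity
  exact ⟨pow_nonneg h m, pow_le_one₀ h ((div_le_one (by positivity)).2 (by linarith))⟩

theorem continuousOn_laplaceSolution_integrand (α l : ℝ) (m : ℕ) :
    ContinuousOn (fun x => Real.exp (-l * x) * (1 + x) ^ α * (x / (1 + x)) ^ m) (Set.Ici 0) := by
  have h : ∀ x ∈ Set.Ici (0 : ℝ), 1 + x ≠ 0 := fun x (hx : 0 ≤ x) => by positivity
  refine ContinuousOn.mul (ContinuousOn.mul (by fun_prop) ?_) ?_
  · exact ContinuousOn.rpow_const (by fun_prop) fun x hx => Or.inl (h x hx)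
  · exact (ContinuousOn.div (by fun_prop) (by fun_prop) h).pow m

theorem laplaceSolution_integrand_mem {α l x : ℝ} (hα₁ : α ≤ 1) (hl : 0 < l) (hx : 0 ≤ x)
    (m : ℕ) : 0 ≤ Real.exp (-l * x) * (1 + x) ^ α * (x / (1 + x)) ^ m ∧
      Real.exp (-l * x) * (1 + x) ^ α * (x / (1 + x)) ^ m ≤
        (1 + 2 / l) * Real.exp (-(l / 2) * x) := by
  obtain ⟨h1, h2⟩ := div_one_add_pow_mem hx m
  have h3 : 0 ≤ Real.exp (-l * x) * (1 + x) ^ α := by positivity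
  exact ⟨mul_nonneg h3 h1, (mul_le_of_le_one_right h3 h2).trans (exp_mul_rpow_le hα₁ hl hx)⟩

theorem integrableOn_laplaceSolution_integrand {α l : ℝ} (hα₁ : α ≤ 1) (hl : 0 < l) (m : ℕ) :
    IntegrableOn (fun x => Real.exp (-l * x) * (1 + x) ^ α * (x / (1 + x)) ^ m) (Set.Ioi 0) := by
  refine Integrable.mono' ((integrableOn_exp_mul_Ioi (a := -(l / 2)) (by linarith) 0).const_mul
    (1 + 2 / l)) ?_ ?_
  · exact ((continuousOn_laplaceSolution_integrand α l m).mono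
      Set.Ioi_subset_Ici_self).aestronglyMeasurable measurableSet_Ioi
  · filter_upwards [ae_restrict_mem measurableSet_Ioi] with x hx
    obtain ⟨h1, h2⟩ := laplaceSolution_integrand_mem hα₁ hl (le_of_lt hx) m
    rwa [Real.norm_eq_abs, abs_of_nonneg h1]

/-- With `y = x / (1 + x)` one has `1 / (1 + x) = 1 - y` and `y' = (1 - y)^2`, so the logarithmic
derivative of the integrand is `-l + α (1 - y) + m (1 - y)^2 / y`. Expanding in powers of `y` gives
exactly the rates of `Q_α`. The integrand vanishes at infinity, and its value `0 ^ m` at `x = 0` is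
the inhomogeneity. The truncated `m - 1` at `m = 0` is harmless, its coefficient being `0`. -/
theorem laplaceSolution_recurrence {α l : ℝ} (hα₁ : α ≤ 1) (hl : 0 < l) (m : ℕ) :
    l * laplaceSolution α l m = 0 ^ m + (m - α) * laplaceSolution α l (m + 1) +
      m * laplaceSolution α l (m - 1) - (2 * m - α) * laplaceSolution α l m := by
  set f : ℕ → ℝ → ℝ := fun k x => Real.exp (-l * x) * (1 + x) ^ α * (x / (1 + x)) ^ k with hf
  have hint : ∀ k, IntegrableOn (f k) (Set.Ioi 0) :=
    fun k => integrableOn_laplaceSolution_integrand hα₁ hl k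
  have hderiv : ∀ x ∈ Set.Ioi (0 : ℝ), HasDerivAt (f m)
      ((m - α) * f (m + 1) x + m * f (m - 1) x - (2 * m - α + l) * f m x) x := by
    intro x (hx : 0 < x)
    have hx1 : 0 < 1 + x := by positivity
    have h1 : HasDerivAt (fun x => Real.exp (-l * x)) (Real.exp (-l * x) * (-l)) x := by
      simpa using ((hasDerivAt_id x).const_mul (-l)).exp
    have h2 : HasDerivAt (fun x : ℝ => 1 + x) 1 x := (hasDerivAt_id x).const_add 1
    have h3 := h2.rpow_const (p := α) (Or.inl hx1.ne')
    have h4 := ((hasDerivAt_id x).div h2 hx1.ne').pow m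
    refine ((h1.mul h3).mul h4).congr_deriv ?_
    have h5 : (1 + x) ^ (α - 1) = (1 + x) ^ α / (1 + x) := Real.rpow_sub_one hx1.ne' α
    simp only [hf, h5, id, Pi.mul_apply, Pi.pow_apply, Pi.div_apply]
    rcases m with _ | n
    · simp
      field_simp
      ring
    · simp only [Nat.add_sub_cancel, pow_succ]
      push_cast
      generalize (x / (1 + x)) ^ n = y
      field_simp
      ring
  have htend : Tendsto (f m) atTop (𝓝 0) := by
    have h0 : Tendsto (fun x => (1 + 2 / l) * Real.exp (-(l / 2) * x)) atTop (𝓝 0) := by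
      simpa using (Real.tendsto_exp_atBot.comp
        (tendsto_id.const_mul_atTop_of_neg (by linarith : -(l / 2) < 0))).const_mul (1 + 2 / l)
    refine squeeze_zero' ?_ ?_ h0
    · filter_upwards [eventually_ge_atTop 0] with x hx
      exact (laplaceSolution_integrand_mem hα₁ hl hx m).1
    · filter_upwards [eventually_ge_atTop 0] with x hx
      exact (laplaceSolution_integrand_mem hα₁ hl hx m).2
  have hint1 : IntegrableOn (fun x => (m - α) * f (m + 1) x + m * f (m - 1) x) (Set.Ioi 0) :=
    ((hint (m + 1)).const_mul _).add ((hint (m - 1)).const_mul _)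
  have hint2 : IntegrableOn (fun x => (2 * m - α + l) * f m x) (Set.Ioi 0) :=
    (hint m).const_mul _
  have h := integral_Ioi_of_hasDerivAt_of_tendsto
    ((continuousOn_laplaceSolution_integrand α l m) 0 Set.self_mem_Ici) hderiv
    (hint1.sub hint2) htend
  rw [integral_sub hint1 hint2, integral_add ((hint (m + 1)).const_mul _)
    ((hint (m - 1)).const_mul _), integral_const_mul, integral_const_mul, integral_const_mul] at h
  have hf0 : f m 0 = 0 ^ m := by simp [hf]
  change _ = 0 - f m 0 at h
  rw [hf0] at h
  simp only [laplaceSolution]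
  linarith

/-- The substitution `t = l (1 + x)`, carried out as a scaling followed by a translation. -/
theorem laplaceSolution_zero {α l : ℝ} (hl : 0 < l) :
    laplaceSolution α l 0 = Real.exp l * incompleteGamma (1 + α) l / l ^ (1 + α) := by
  have h1 := integral_comp_mul_left_Ioi (fun t => Real.exp (-t) * t ^ α) 1 hl
  have h2 := (measurePreserving_add_left volume (1 : ℝ)).setIntegral_preimage_emb
    (MeasurableEquiv.addLeft (1 : ℝ)).measurableEmbedding
    (fun x => Real.exp (-(l * x)) * (l * x) ^ α) (Set.Ioi 1)
  have h3 : (fun x : ℝ => 1 + x) ⁻¹' Set.Ioi 1 = Set.Ioi 0 := by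
    ext x
    simp
  rw [h3, h1] at h2
  simp only [laplaceSolution, incompleteGamma, pow_zero, mul_one, add_sub_cancel_left]
  rw [mul_one] at h2
  have h4 : ∫ x in Set.Ioi (0 : ℝ), Real.exp (-(l * (1 + x))) * (l * (1 + x)) ^ α =
      Real.exp (-l) * l ^ α * ∫ x in Set.Ioi (0 : ℝ), Real.exp (-l * x) * (1 + x) ^ α := by
    rw [← integral_const_mul]
    refine setIntegral_congr_fun measurableSet_Ioi fun x (hx : 0 < x) => ?_
    rw [Real.mul_rpow hl.le (by positivity), show -(l * (1 + x)) = -l + -l * x by ring,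
      Real.exp_add]
    ring
  rw [h4, Real.exp_neg, smul_eq_mul] at h2
  have h5 : 0 < l ^ α := Real.rpow_pos_of_pos hl α
  rw [Real.rpow_add hl, Real.rpow_one]
  have h6 := Real.exp_pos l
  field_simp at h2 ⊢
  linarith

theorem integrableOn_incompleteGamma {a z : ℝ} (ha : 0 < a) (hz : 0 ≤ z) :
    IntegrableOn (fun t => Real.exp (-t) * t ^ (a - 1)) (Set.Ioi z) :=
  (Real.GammaIntegral_convergent ha).mono_set (Set.Ioi_subset_Ioi hz)

theorem incompleteGamma_pos {a z : ℝ} (ha : 0 < a) (hz : 0 ≤ z) : 0 < incompleteGamma a z := by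
  have h : ∀ t ∈ Set.Ioi z, 0 < Real.exp (-t) * t ^ (a - 1) := fun t ht =>
    mul_pos (Real.exp_pos _) (Real.rpow_pos_of_pos (hz.trans_lt ht) _)
  rw [incompleteGamma, setIntegral_pos_iff_support_of_nonneg_ae
    ((ae_restrict_mem measurableSet_Ioi).mono fun t ht => (h t ht).le)
    (integrableOn_incompleteGamma ha hz)]
  rw [Set.inter_eq_right.2 fun t ht => Function.mem_support.2 (h t ht).ne']
  simp

theorem incompleteGamma_anti {a y z : ℝ} (ha : 0 < a) (hy : 0 ≤ y) (hyz : y ≤ z) :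
    incompleteGamma a z ≤ incompleteGamma a y :=
  setIntegral_mono_set (integrableOn_incompleteGamma ha hy)
    ((ae_restrict_mem measurableSet_Ioi).mono fun _ ht =>
      mul_nonneg (Real.exp_pos _).le (Real.rpow_nonneg (hy.trans (le_of_lt ht)) _))
    (Set.Ioi_subset_Ioi hyz).eventuallyLE

theorem laplaceSolution_zero_pos {α l : ℝ} (hα₀ : 0 < α) (hl : 0 < l) :
    0 < laplaceSolution α l 0 := by
  rw [laplaceSolution_zero hl]
  have := incompleteGamma_pos (by linarith : 0 < 1 + α) hl.le
  positivity

theorem laplaceSolution_mem {α l : ℝ} (hα₁ : α ≤ 1) (hl : 0 < l) (m : ℕ) :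
    0 ≤ laplaceSolution α l m ∧ laplaceSolution α l m ≤ laplaceSolution α l 0 := by
  constructor
  · exact setIntegral_nonneg measurableSet_Ioi fun x hx =>
      (laplaceSolution_integrand_mem hα₁ hl (le_of_lt hx) m).1
  · refine setIntegral_mono_on (integrableOn_laplaceSolution_integrand hα₁ hl m)
      (integrableOn_laplaceSolution_integrand hα₁ hl 0) measurableSet_Ioi fun x (hx : 0 < x) => ?_
    gcongr ?_ * ?_
    simpa using (div_one_add_pow_mem hx.le m).2

/-- The bounded solution of `(l - Q_α) φ = 0` on `{1, 2, …}` with `φ 0 = 1`, evaluated at `1`. -/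
theorem apply_one_eq_of_recurrence {α l : ℝ} (hα₀ : 0 < α) (hα₁ : α ≤ 1) (hl : 0 < l)
    {φ : ℕ → ℝ} (hφ : ∀ m, 0 ≤ φ m ∧ φ m ≤ 1) (h0 : φ 0 = 1)
    (hrec : ∀ m : ℕ, l * φ (m + 1) = (m + 1 - α) * φ (m + 2) + (m + 1) * φ m -
      (2 * (m + 1) - α) * φ (m + 1)) :
    φ 1 = 1 - l / α + l ^ (1 + α) / (α * Real.exp l * incompleteGamma (1 + α) l) := by
  have hpos := laplaceSolution_zero_pos hα₀ hl
  set ψ : ℕ → ℝ := fun m => laplaceSolution α l m / laplaceSolution α l 0 with hψ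
  have hψm : ∀ m, 0 ≤ ψ m ∧ ψ m ≤ 1 := fun m =>
    ⟨div_nonneg (laplaceSolution_mem hα₁ hl m).1 hpos.le,
      (div_le_one hpos).2 (laplaceSolution_mem hα₁ hl m).2⟩
  have hψ0 : ψ 0 = 1 := div_self hpos.ne'
  have hψrec : ∀ m : ℕ, l * ψ (m + 1) = (m + 1 - α) * ψ (m + 2) + (m + 1) * ψ m -
      (2 * (m + 1) - α) * ψ (m + 1) := by
    intro m
    have h := laplaceSolution_recurrence hα₁ hl (m + 1)
    push_cast at h
    simp only [ne_eq, Nat.add_eq_zero_iff, one_ne_zero, and_false,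
      not_false_eq_true, zero_pow, zero_add] at h
    simp only [hψ]
    field_simp
    linarith
  -- Uniqueness is one-sided, so it is applied to both differences.
  have hle : φ 1 - ψ 1 ≤ 0 :=
    apply_one_nonpos_of_recurrence hα₀ hα₁ hl (d := fun m => φ m - ψ m) (C := 1)
      (fun m => by linarith [(hφ m).2, (hψm m).1]) (by rw [h0, hψ0, sub_self])
      (fun m => by linear_combination hrec m - hψrec m)
  have hge : ψ 1 - φ 1 ≤ 0 :=
    apply_one_nonpos_of_recurrence hα₀ hα₁ hl (d := fun m => ψ m - φ m) (C := 1)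
      (fun m => by linarith [(hψm m).2, (hφ m).1]) (by rw [h0, hψ0, sub_self])
      (fun m => by linear_combination hψrec m - hrec m)
  have h1 : φ 1 = ψ 1 := by linarith
  -- At `m = 0` the inhomogeneous term equals `1`, and the relation involves only the values at `0`
  -- and `1`.
  have h2 := laplaceSolution_recurrence hα₁ hl 0
  simp only [pow_zero, Nat.cast_zero, zero_add, zero_mul, add_zero, zero_sub, mul_zero] at h2
  have h3 : ψ 1 = 1 - l / α + 1 / (α * laplaceSolution α l 0) := by
    simp only [hψ]
    field_simp
    linarith
  have h4 := incompleteGamma_pos (by linarith : 0 < 1 + α) hl.le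
  have h5 : 0 < l ^ (1 + α) := Real.rpow_pos_of_pos hl _
  rw [h1, h3, laplaceSolution_zero hl]
  congr 1
  field_simp

/-! ### The Laplace transform of `p t 1 0` -/

theorem sum_qMatrix_succ_mul (α : ℝ) (m : ℕ) (f : ℕ → ℝ) :
    ∑ k ∈ {m, m + 1, m + 2}, qMatrix α (m + 1) k * f k =
      (m + 1 - α) * f (m + 2) + (m + 1) * f m - (2 * (m + 1) - α) * f (m + 1) := by
  rw [Finset.sum_insert (by simp), Finset.sum_insert (by simp), Finset.sum_singleton]
  have h1 : qMatrix α (m + 1) m = m + 1 := by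
    rw [qMatrix, if_neg (by omega), if_neg (by omega), if_pos rfl]
    simp
  have h2 : qMatrix α (m + 1) (m + 1) = -(2 * (m + 1) - α) := by simp [qMatrix]
  have h3 : qMatrix α (m + 1) (m + 2) = m + 1 - α := by simp [qMatrix]
  rw [h1, h2, h3]
  ring

theorem sum_qMatrix_succ (α : ℝ) (m : ℕ) :
    ∑ k ∈ {m, m + 1, m + 2}, qMatrix α (m + 1) k = 0 := by
  have := sum_qMatrix_succ_mul α m 1
  simp only [Pi.one_apply, mul_one] at this
  rw [this]
  ring

namespace IsTransitionFunction

variable {p : ℝ → Matrix ℕ ℕ ℝ} {α : ℝ}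

theorem laplace_one_zero (hp : IsTransitionFunction p) (hQ : HasQMatrix p (qMatrix α))
    (hα₀ : 0 < α) (hα₁ : α ≤ 1) {l : ℝ} (hl : 0 < l) :
    l * ∫ t in Set.Ioi 0, Real.exp (-l * t) * p t 1 0 =
      1 - l / α + l ^ (1 + α) / (α * Real.exp l * incompleteGamma (1 + α) l) := by
  have hexp : ∫ t in Set.Ioi 0, Real.exp (-l * t) = 1 / l := by
    rw [integral_exp_mul_Ioi (neg_lt_zero.2 hl)]
    simp [neg_div]
  refine apply_one_eq_of_recurrence hα₀ hα₁ hl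
    (φ := fun m => l * ∫ t in Set.Ioi 0, Real.exp (-l * t) * p t m 0) (fun m => ⟨?_, ?_⟩) ?_
    fun m => ?_
  · exact mul_nonneg hl.le (setIntegral_nonneg measurableSet_Ioi fun t ht =>
      mul_nonneg (Real.exp_pos _).le (hp.nonneg t (le_of_lt ht) m 0))
  · have h : ∫ t in Set.Ioi 0, Real.exp (-l * t) * p t m 0 ≤ ∫ t in Set.Ioi 0, Real.exp (-l * t) :=
      setIntegral_mono_on (hp.integrableOn_exp_mul hQ hl m 0)
        (integrableOn_exp_mul_Ioi (neg_lt_zero.2 hl) 0) measurableSet_Ioi fun t ht =>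
        mul_le_of_le_one_right (Real.exp_pos _).le (hp.le_one (le_of_lt ht) m 0)
    rw [hexp, le_div_iff₀ hl] at h
    linarith
  · have h : ∫ t in Set.Ioi 0, Real.exp (-l * t) * p t 0 0 = ∫ t in Set.Ioi 0, Real.exp (-l * t) :=
      setIntegral_congr_fun measurableSet_Ioi fun t ht => by
        simp [hp.apply_self_eq_one hQ (i := 0) (by simp [qMatrix]) (le_of_lt ht)]
    simp only [h, hexp]
    field_simp
  · have h := hp.laplace_backward hQ (i := m + 1) (S := {m, m + 1, m + 2}) (by simp)
      (sum_qMatrix_succ α m) 0 hl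
    rw [sum_qMatrix_succ_mul] at h
    simp only [hp.zero, ne_eq, Nat.add_eq_zero_iff, one_ne_zero, and_false, not_false_eq_true,
      Matrix.one_apply_ne, zero_add] at h
    linear_combination l * h

/-- For `α = 1` state `2` drops out of the backward equation at `1`, leaving `p' = 1 - p`. Hence
`e^t (1 - p t 1 0)` is constant. -/
theorem apply_one_zero_of_eq_one (hp : IsTransitionFunction p) (hQ : HasQMatrix p (qMatrix 1))
    {t : ℝ} (ht : 0 ≤ t) : p t 1 0 = 1 - Real.exp (-t) := by
  have h := constant_of_has_deriv_right_zero (f := fun s => Real.exp s * (1 - p s 1 0)) (a := 0)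
    (b := t) ?_ ?_ t ⟨ht, le_rfl⟩
  · simp only [Real.exp_zero, hp.zero, ne_eq, one_ne_zero, not_false_eq_true, Matrix.one_apply_ne,
      sub_zero, mul_one] at h
    rw [Real.exp_neg, ← one_div, eq_sub_iff_add_eq', ← eq_sub_iff_add_eq, div_eq_iff
      (Real.exp_pos t).ne', mul_comm]
    exact h.symm
  · exact (Continuous.continuousOn (by fun_prop)).mul (continuousOn_const.sub
      ((hp.continuousOn hQ 1 0).mono Set.Icc_subset_Ici_self))
  · intro s hs
    have h1 := hp.hasDerivWithinAt hQ (i := 1) (S := {0, 0 + 1, 0 + 2}) (by simp)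
      (sum_qMatrix_succ 1 0) 0 hs.1
    rw [sum_qMatrix_succ_mul 1 0 (fun k => p s k 0),
      hp.apply_self_eq_one hQ (i := 0) (by simp [qMatrix]) hs.1] at h1
    refine ((Real.hasDerivAt_exp s).hasDerivWithinAt.mul (h1.const_sub 1)).congr_deriv ?_
    simp
    ring

end IsTransitionFunction

/-! ### The hitting time: measurability, and its law in terms of `p` -/

section HittingTime

variable {Ω : Type*} {Z : ℝ≥0 → Ω → ℕ} {ω : Ω}

theorem hittingTimeZero_lt_iff {a : ℝ≥0∞} :
    hittingTimeZero Z ω < a ↔ ∃ s : ℝ≥0, Z s ω = 0 ∧ (s : ℝ≥0∞) < a := by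
  simp [hittingTimeZero, iInf_lt_iff]

theorem exists_Ico_eq_of_right_continuous {t : ℝ≥0}
    (h : ContinuousWithinAt (fun s => Z s ω) (Set.Ici t) t) :
    ∃ u, t < u ∧ ∀ s ∈ Set.Ico t u, Z s ω = Z t ω := by
  have h1 : {s | Z s ω = Z t ω} ∈ 𝓝[≥] t := h.preimage_mem_nhdsWithin (mem_nhds_discrete.2 (Set.mem_singleton _))
  obtain ⟨u, hu, hsub⟩ := (mem_nhdsGE_iff_exists_Ico_subset' (lt_add_one t)).1 h1
  exact ⟨u, hu, hsub⟩

/-- By right-continuity a zero at `s` persists on some `[s, u)`, which contains a rational time. The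
countable form gives measurability and lets null sets be united. -/
theorem hittingTimeZero_lt_iff_rat
    (h : ∀ t, ContinuousWithinAt (fun s => Z s ω) (Set.Ici t) t) {a : ℝ≥0∞} :
    hittingTimeZero Z ω < a ↔
      ∃ q : ℚ, (Real.toNNReal q : ℝ≥0∞) < a ∧ Z (Real.toNNReal q) ω = 0 := by
  rw [hittingTimeZero_lt_iff]
  constructor
  · rintro ⟨s, hs, hsa⟩
    obtain ⟨u, hu, hsu⟩ := exists_Ico_eq_of_right_continuous (h s)
    obtain ⟨q, -, hq1, hq2⟩ := ENNReal.lt_iff_exists_rat_btwn.1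
      (lt_min (ENNReal.coe_lt_coe.2 hu) hsa)
    refine ⟨q, hq2.trans_le (min_le_right _ _), ?_⟩
    rw [hsu _ ⟨(ENNReal.coe_lt_coe.1 hq1).le,
      ENNReal.coe_lt_coe.1 (hq2.trans_le (min_le_left _ _))⟩, hs]
  · rintro ⟨q, hq, hZ⟩
    exact ⟨_, hZ, hq⟩

end HittingTime

/-- The Laplace transform of a nonnegative random variable in terms of its distribution function. -/
theorem integral_exp_neg_mul_eq {Ω : Type*} [MeasurableSpace Ω] (μ : Measure Ω)
    [IsProbabilityMeasure μ] {T : Ω → ℝ} (hT : Measurable T) (hT0 : ∀ ω, 0 ≤ T ω) {l : ℝ}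
    (hl : 0 < l) :
    ∫ ω, Real.exp (-l * T ω) ∂μ =
      l * ∫ t in Set.Ioi 0, Real.exp (-l * t) * μ.real {ω | T ω ≤ t} := by
  -- Fubini for `e^{-lT} = l ∫_T^∞ e^{-lt} dt`, with the domain written as an indicator.
  have hexp : IntegrableOn (fun t => Real.exp (-l * t)) (Set.Ioi 0) :=
    integrableOn_exp_mul_Ioi (neg_lt_zero.2 hl) 0
  set F : Ω → ℝ → ℝ := fun ω t => (Set.Ici (T ω)).indicator (fun t => Real.exp (-l * t)) t with hF
  have hS : MeasurableSet {x : Ω × ℝ | T x.1 ≤ x.2} :=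
    measurableSet_le (hT.comp measurable_fst) measurable_snd
  have hFint : Integrable (Function.uncurry F) (μ.prod (volume.restrict (Set.Ioi 0))) := by
    have h1 : Integrable (fun x : Ω × ℝ => Real.exp (-l * x.2))
        (μ.prod (volume.restrict (Set.Ioi 0))) := by
      simpa using (integrable_const (1 : ℝ)).mul_prod (μ := μ) hexp
    refine (h1.indicator hS).congr (Eventually.of_forall fun x => ?_)
    simp [hF, Function.uncurry, Set.indicator_apply]
  have hswap := integral_integral_swap hFint
  have hleft : ∀ ω, ∫ t in Set.Ioi 0, F ω t = Real.exp (-l * T ω) / l := by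
    intro ω
    rw [setIntegral_congr_set Ioi_ae_eq_Ici, setIntegral_indicator measurableSet_Ici,
      Set.inter_eq_right.2 (Set.Ici_subset_Ici.2 (hT0 ω)), integral_Ici_eq_integral_Ioi,
      integral_exp_mul_Ioi (neg_lt_zero.2 hl), neg_div_neg_eq]
  have hright : ∀ t, ∫ ω, F ω t ∂μ = Real.exp (-l * t) * μ.real {ω | T ω ≤ t} := by
    intro t
    have : ∀ ω, F ω t = {ω | T ω ≤ t}.indicator (fun _ => Real.exp (-l * t)) ω := by
      intro ω
      simp [hF, Set.indicator_apply]
    simp only [this]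
    rw [integral_indicator_const _ (measurableSet_le hT measurable_const), smul_eq_mul, mul_comm]
  simp only [hleft, hright, integral_div] at hswap
  rw [← hswap]
  field_simp

namespace IsMarkovChain

variable {Ω : Type*} [MeasurableSpace Ω] {Q : Matrix ℕ ℕ ℝ} {x₀ : ℕ} {Z : ℝ≥0 → Ω → ℕ}
  {μ : Measure Ω}

theorem measurable_hittingTimeZero (hZ : IsMarkovChain Q x₀ Z μ) :
    Measurable (hittingTimeZero Z) := by
  refine measurable_of_Iio fun a => ?_
  have : hittingTimeZero Z ⁻¹' Set.Iio a =
      ⋃ q : ℚ, {ω | (Real.toNNReal q : ℝ≥0∞) < a ∧ Z (Real.toNNReal q) ω = 0} := by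
    ext ω
    simpa using hittingTimeZero_lt_iff_rat (hZ.right_continuous ω)
  rw [this]
  exact MeasurableSet.iUnion fun q => (MeasurableSet.const _).inter
    (hZ.measurable _ (measurableSet_singleton 0))

/-- If `0` is absorbing, the distribution function of the hitting time of `0` is an entry of the
transition function. -/
theorem exists_transitionFunction [IsProbabilityMeasure μ] (hZ : IsMarkovChain Q x₀ Z μ)
    (h0 : Q 0 0 = 0) : ∃ p : ℝ → Matrix ℕ ℕ ℝ, IsTransitionFunction p ∧ HasQMatrix p Q ∧
      ∀ t : ℝ≥0, μ.real {ω | hittingTimeZero Z ω ≤ t} = p t x₀ 0 := by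
  obtain ⟨p, hp, hQ, hmk⟩ := hZ.markov
  refine ⟨p, hp, hQ, fun t => ?_⟩
  have hmk2 : ∀ s t : ℝ≥0, s ≤ t → ∀ i j, μ.real {ω | Z s ω = i ∧ Z t ω = j} =
      μ.real {ω | Z s ω = i} * p (t - s) i j := by
    intro s t hst i j
    have hmono : Monotone ![s, t] := by
      rw [Fin.monotone_iff_le_succ]
      intro k
      fin_cases k
      simpa using hst
    simpa [Fin.forall_fin_two] using hmk 1 ![s, t] hmono ![i, j]
  have hrow : ∀ t, 0 ≤ t → ∀ j, j ≠ 0 → p t 0 j = 0 := by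
    intro t ht j hj
    have h1 := sum_le_hasSum {0, j} (fun k _ => hp.nonneg t ht 0 k) (hp.row_sum t ht 0)
    rw [Finset.sum_pair hj.symm, hp.apply_self_eq_one hQ h0 ht] at h1
    linarith [hp.nonneg t ht 0 j]
  -- Absorption of paths for one fixed pair of times: each of the countably many escapes from `0` to
  -- `j ≠ 0` has probability zero by `hrow`.
  have habs : ∀ s t : ℝ≥0, s ≤ t → ∀ᵐ ω ∂μ, Z s ω = 0 → Z t ω = 0 := by
    intro s t hst
    have h1 : ∀ j, ∀ᵐ ω ∂μ, j ≠ 0 → ¬ (Z s ω = 0 ∧ Z t ω = j) := by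
      intro j
      by_cases hj : j = 0
      · simp [hj]
      · have h2 := hmk2 s t hst 0 j
        rw [hrow _ (sub_nonneg.2 (NNReal.coe_le_coe.2 hst)) j hj, mul_zero,
          measureReal_eq_zero_iff] at h2
        have h3 : ∀ᵐ ω ∂μ, ¬ (Z s ω = 0 ∧ Z t ω = j) := by
          rw [ae_iff]
          simpa using h2
        exact h3.mono fun ω h _ => h
    filter_upwards [ae_all_iff.2 h1] with ω hω hs
    by_contra h
    exact hω _ h ⟨hs, rfl⟩
  have hae : {ω | hittingTimeZero Z ω ≤ t} =ᵐ[μ] {ω | Z t ω = 0} := by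
    have h1 : ∀ᵐ ω ∂μ, ∀ q : ℚ, Real.toNNReal q ≤ t → Z (Real.toNNReal q) ω = 0 → Z t ω = 0 := by
      refine ae_all_iff.2 fun q => ?_
      by_cases hq : Real.toNNReal q ≤ t
      · exact (habs _ _ hq).mono fun ω h _ => h
      · exact Eventually.of_forall fun ω h => absurd h hq
    filter_upwards [h1] with ω hω
    refine propext ⟨fun (h : _ ≤ _) => ?_, fun (h : Z t ω = 0) => iInf₂_le t h⟩
    change Z t ω = 0
    -- The infimum may equal `t`, so the rational zero is only known to lie before `u`. Up to `t`
    -- absorption applies; between `t` and `u` the path is constant.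
    obtain ⟨u, hu, htu⟩ := exists_Ico_eq_of_right_continuous (hZ.right_continuous ω t)
    obtain ⟨q, hq, hZq⟩ := (hittingTimeZero_lt_iff_rat (hZ.right_continuous ω)).1
      (lt_of_le_of_lt h (ENNReal.coe_lt_coe.2 hu))
    rcases le_total (Real.toNNReal q) t with hqt | hqt
    · exact hω q hqt hZq
    · rw [← htu _ ⟨hqt, ENNReal.coe_lt_coe.1 hq⟩, hZq]
  rw [measureReal_congr hae]
  have h2 := hmk2 0 t zero_le x₀ 0
  have h3 : {ω | Z 0 ω = x₀ ∧ Z t ω = 0} =ᵐ[μ] {ω | Z t ω = 0} := by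
    filter_upwards [hZ.start] with ω hω
    exact propext ⟨fun h => h.2, fun h => ⟨hω, h⟩⟩
  have h4 : {ω | Z 0 ω = x₀} =ᵐ[μ] Set.univ := by
    filter_upwards [hZ.start] with ω hω
    exact propext ⟨fun _ => trivial, fun _ => hω⟩
  rw [measureReal_congr h3, measureReal_congr h4] at h2
  simpa using h2

end IsMarkovChain

/-! ### Small `l`: finiteness and the mean -/

/-- Along `l = 1 / (n + 1)` the quotient is `1 / α` minus a term of order `l ^ α`, because `Γ(1 + α,
l) ≥ Γ(1 + α, 1) > 0` for `l ≤ 1`. -/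
theorem tendsto_one_sub_laplace_div {α : ℝ} (hα₀ : 0 < α) :
    Tendsto (fun n : ℕ => (1 - (1 - (1 / ((n : ℝ) + 1)) / α +
      (1 / ((n : ℝ) + 1)) ^ (1 + α) / (α * Real.exp (1 / ((n : ℝ) + 1)) *
        incompleteGamma (1 + α) (1 / ((n : ℝ) + 1))))) / (1 / ((n : ℝ) + 1)))
      atTop (𝓝 (1 / α)) := by
  have hα : 0 < 1 + α := by linarith
  have hG := incompleteGamma_pos hα zero_le_one
  have h0 : Tendsto (fun n : ℕ => (1 / ((n : ℝ) + 1)) ^ α / (α * incompleteGamma (1 + α) 1))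
      atTop (𝓝 0) := by
    have := (tendsto_one_div_add_atTop_nhds_zero_nat (𝕜 := ℝ)).rpow_const
      (p := α) (Or.inr hα₀.le)
    rw [Real.zero_rpow hα₀.ne'] at this
    simpa using this.div_const (α * incompleteGamma (1 + α) 1)
  have h1 : Tendsto (fun n : ℕ => (1 / ((n : ℝ) + 1)) ^ α / (α * Real.exp (1 / ((n : ℝ) + 1)) *
        incompleteGamma (1 + α) (1 / ((n : ℝ) + 1)))) atTop (𝓝 0) := by
    refine squeeze_zero (fun n => ?_) (fun n => ?_) h0
    · have := incompleteGamma_pos hα (by positivity : 0 ≤ 1 / ((n : ℝ) + 1))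
      positivity
    · have hn : 1 / ((n : ℝ) + 1) ≤ 1 := by
        rw [div_le_one (by positivity)]
        linarith [(n.cast_nonneg : (0 : ℝ) ≤ n)]
      have h2 := incompleteGamma_anti hα (by positivity : 0 ≤ 1 / ((n : ℝ) + 1)) hn
      have h3 : 1 ≤ Real.exp (1 / ((n : ℝ) + 1)) := Real.one_le_exp (by positivity)
      gcongr
      exact le_mul_of_one_le_right hα₀.le h3
  have h2 := h1.const_sub (1 / α)
  rw [sub_zero] at h2
  refine h2.congr fun n => ?_
  have hl : 0 < 1 / ((n : ℝ) + 1) := by positivity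
  generalize 1 / ((n : ℝ) + 1) = l at hl
  have := incompleteGamma_pos hα hl.le
  rw [Real.rpow_add hl, Real.rpow_one]
  field_simp
  ring

variable {Ω : Type*} [MeasurableSpace Ω] {μ : Measure Ω} [IsProbabilityMeasure μ]
  {p : ℝ → Matrix ℕ ℕ ℝ} {α : ℝ}

/-- A random time whose distribution function is `p · 1 0` is almost surely finite. -/
theorem ae_lt_top_of_cdf {ζ : Ω → ℝ≥0∞} (hζ : Measurable ζ) (hp : IsTransitionFunction p)
    (hQ : HasQMatrix p (qMatrix α)) (hα₀ : 0 < α) (hα₁ : α ≤ 1)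
    (hcdf : ∀ t : ℝ≥0, μ.real {ω | ζ ω ≤ t} = p t 1 0) : ∀ᵐ ω ∂μ, ζ ω < ∞ := by
  set c := μ.real {ω | ζ ω = ∞} with hc
  have hmeas : MeasurableSet {ω | ζ ω = ∞} := hζ (measurableSet_singleton ∞)
  have h1 : ∀ t : ℝ, 0 ≤ t → p t 1 0 ≤ 1 - c := by
    intro t ht
    rw [hc, ← probReal_compl_eq_one_sub hmeas]
    lift t to ℝ≥0 using ht
    rw [← hcdf t]
    exact measureReal_mono fun ω (hω : ζ ω ≤ t) => (hω.trans_lt ENNReal.coe_lt_top).ne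
  -- The mass `c` at infinity caps `p t 1 0` by `1 - c`, hence caps its transform, which is at least
  -- `1 - l / α`. Then `l` tends to `0`.
  have h2 : ∀ l : ℝ, 0 < l → c ≤ l / α := by
    intro l hl
    have hint := integrableOn_exp_mul_Ioi (neg_lt_zero.2 hl) 0
    have h3 : ∫ t in Set.Ioi 0, Real.exp (-l * t) * p t 1 0 ≤
        ∫ t in Set.Ioi 0, Real.exp (-l * t) * (1 - c) :=
      setIntegral_mono_on (hp.integrableOn_exp_mul hQ hl 1 0) (hint.mul_const _)
        measurableSet_Ioi fun t ht =>
        mul_le_mul_of_nonneg_left (h1 t (le_of_lt ht)) (Real.exp_pos _).le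
    have h4 := mul_le_mul_of_nonneg_left h3 hl.le
    rw [hp.laplace_one_zero hQ hα₀ hα₁ hl, integral_mul_const,
      integral_exp_mul_Ioi (neg_lt_zero.2 hl), neg_div_neg_eq, mul_zero, Real.exp_zero,
      ← mul_assoc, mul_one_div_cancel hl.ne', one_mul] at h4
    have h5 := incompleteGamma_pos (by linarith : 0 < 1 + α) hl.le
    have h6 : 0 ≤ l ^ (1 + α) / (α * Real.exp l * incompleteGamma (1 + α) l) := by positivity
    linarith
  have h3 : c ≤ 0 := by
    refine le_of_forall_pos_le_add fun ε hε => ?_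
    have := h2 (α * ε) (by positivity)
    rwa [mul_div_cancel_left₀ _ hα₀.ne', ← zero_add ε] at this
  have h4 : c = 0 := le_antisymm h3 measureReal_nonneg
  rw [hc, measureReal_eq_zero_iff] at h4
  rw [ae_iff]
  simpa using h4

/-- The tail integral of `ζ`: the damping factor `e^{-lt}` increases to `1` along `l = 1 / (n + 1)`,
so monotone convergence reduces it to the small-`l` limit of the transform. -/
theorem lintegral_one_sub_eq (hp : IsTransitionFunction p) (hQ : HasQMatrix p (qMatrix α))
    (hα₀ : 0 < α) (hα₁ : α ≤ 1) :
    ∫⁻ t in Set.Ioi 0, ENNReal.ofReal (1 - p t 1 0) = ENNReal.ofReal (1 / α) := by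
  have hint : ∀ l : ℝ, 0 < l →
      IntegrableOn (fun t => Real.exp (-l * t) * (1 - p t 1 0)) (Set.Ioi 0) := by
    intro l hl
    simpa only [mul_sub, mul_one] using! (integrableOn_exp_mul_Ioi (neg_lt_zero.2 hl) 0).sub
      (hp.integrableOn_exp_mul hQ hl 1 0)
  have hval : ∀ l : ℝ, 0 < l → ∫⁻ t in Set.Ioi 0, ENNReal.ofReal
      (Real.exp (-l * t) * (1 - p t 1 0)) = ENNReal.ofReal ((1 - (1 - l / α +
        l ^ (1 + α) / (α * Real.exp l * incompleteGamma (1 + α) l))) / l) := by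
    intro l hl
    rw [← ofReal_integral_eq_lintegral_ofReal (hint l hl)]
    · congr 1
      simp only [mul_sub, mul_one]
      rw [integral_sub (integrableOn_exp_mul_Ioi (neg_lt_zero.2 hl) 0)
        (hp.integrableOn_exp_mul hQ hl 1 0), ← hp.laplace_one_zero hQ hα₀ hα₁ hl,
        integral_exp_mul_Ioi (neg_lt_zero.2 hl), neg_div_neg_eq, mul_zero, Real.exp_zero]
      field_simp
    · filter_upwards [ae_restrict_mem measurableSet_Ioi] with t ht
      exact mul_nonneg (Real.exp_pos _).le (sub_nonneg.2 (hp.le_one (le_of_lt ht) 1 0))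
  have hpos : ∀ n : ℕ, 0 < 1 / ((n : ℝ) + 1) := fun n => by positivity
  refine tendsto_nhds_unique (lintegral_tendsto_of_tendsto_of_monotone (f := fun (n : ℕ) t =>
    ENNReal.ofReal (Real.exp (-(1 / ((n : ℝ) + 1)) * t) * (1 - p t 1 0))) (fun n => ?_) ?_ ?_) ?_
  · exact (hint _ (hpos n)).aemeasurable.ennreal_ofReal
  · filter_upwards [ae_restrict_mem measurableSet_Ioi] with t ht
    intro m n hmn
    have h1 : 0 ≤ 1 - p t 1 0 := sub_nonneg.2 (hp.le_one (le_of_lt ht) 1 0)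
    have h2 : (0 : ℝ) ≤ t := le_of_lt ht
    simp only
    gcongr
  · refine Eventually.of_forall fun t => (ENNReal.continuous_ofReal.tendsto _).comp ?_
    have h1 := (((tendsto_one_div_add_atTop_nhds_zero_nat (𝕜 := ℝ)).neg.mul_const t).rexp).mul_const
      (1 - p t 1 0)
    simpa using h1
  · simp only [hval _ (hpos _)]
    exact (ENNReal.continuous_ofReal.tendsto _).comp (tendsto_one_sub_laplace_div hα₀)

end TableSize

/-! ### Assembly of the main theorem -/

/-- The hitting time `ζ` of `0` by a `Q_α`-Markov chain started from `1`: it is a random variable that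
is almost surely finite, its Laplace transform is explicit, it is standard exponential if `α = 1`,
and its mean is `1 / α`. -/
theorem mainTheorem6 (α : ℝ) (hα₀ : 0 < α) (hα₁ : α ≤ 1)
    {Ω : Type*} [MeasurableSpace Ω] (μ : Measure Ω) [IsProbabilityMeasure μ]
    (Z : ℝ≥0 → Ω → ℕ) (hZ : TableSize.IsMarkovChain (TableSize.qMatrix α) 1 Z μ) :
    Measurable (TableSize.hittingTimeZero Z) ∧
    (∀ᵐ ω ∂μ, TableSize.hittingTimeZero Z ω < ∞) ∧
    (∀ l : ℝ, 0 < l →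
      ∫ ω, Real.exp (-l * (TableSize.hittingTimeZero Z ω).toReal) ∂μ =
        1 - l / α +
          l ^ (1 + α) / (α * Real.exp l * TableSize.incompleteGamma (1 + α) l)) ∧
    (α = 1 → HasLaw (fun ω => (TableSize.hittingTimeZero Z ω).toReal) (expMeasure 1) μ) ∧
    ∫⁻ ω, TableSize.hittingTimeZero Z ω ∂μ = ENNReal.ofReal (1 / α) := by
  have hmeas := hZ.measurable_hittingTimeZero
  obtain ⟨p, hp, hQ, hcdf⟩ := hZ.exists_transitionFunction (by simp [TableSize.qMatrix])
  have hfin := TableSize.ae_lt_top_of_cdf hmeas hp hQ hα₀ hα₁ hcdf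
  have hmeasT : Measurable fun ω => (TableSize.hittingTimeZero Z ω).toReal := hmeas.ennreal_toReal
  have hcdfT : ∀ t : ℝ, 0 ≤ t →
      μ.real {ω | (TableSize.hittingTimeZero Z ω).toReal ≤ t} = p t 1 0 := by
    intro t ht
    lift t to ℝ≥0 using ht
    rw [← hcdf t]
    refine measureReal_congr ?_
    -- Finiteness is essential: `toReal` sends `∞` to `0`, where the two events would differ.
    filter_upwards [hfin] with ω hω
    refine propext ?_
    change (TableSize.hittingTimeZero Z ω).toReal ≤ t ↔ TableSize.hittingTimeZero Z ω ≤ t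
    rw [← ENNReal.coe_toReal, ENNReal.toReal_le_toReal hω.ne ENNReal.coe_ne_top]
  refine ⟨hmeas, hfin, fun l hl => ?_, fun hα => ?_, ?_⟩
  · rw [TableSize.integral_exp_neg_mul_eq μ hmeasT (fun _ => ENNReal.toReal_nonneg) hl,
      ← hp.laplace_one_zero hQ hα₀ hα₁ hl]
    congr 1
    exact setIntegral_congr_fun measurableSet_Ioi fun t ht => by
      simp only [hcdfT t (le_of_lt ht)]
  · subst hα
    have := isProbabilityMeasure_expMeasure one_pos
    have := Measure.isProbabilityMeasure_map (μ := μ) hmeasT.aemeasurable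
    refine ⟨hmeasT.aemeasurable, Measure.eq_of_cdf _ _ (StieltjesFunction.ext fun x => ?_)⟩
    rw [cdf_expMeasure_eq one_pos, cdf_eq_real, map_measureReal_apply hmeasT measurableSet_Iic]
    change μ.real {ω | (TableSize.hittingTimeZero Z ω).toReal ≤ x} = _
    split_ifs with hx
    · rw [hcdfT x hx, hp.apply_one_zero_of_eq_one hQ hx, one_mul]
    · have : {ω | (TableSize.hittingTimeZero Z ω).toReal ≤ x} = ∅ :=
        Set.eq_empty_of_forall_notMem fun ω hω => hx (ENNReal.toReal_nonneg.trans hω)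
      rw [this, measureReal_empty]
  · have h1 : ∫⁻ ω, TableSize.hittingTimeZero Z ω ∂μ =
        ∫⁻ ω, ENNReal.ofReal (TableSize.hittingTimeZero Z ω).toReal ∂μ :=
      lintegral_congr_ae (hfin.mono fun ω hω => (ENNReal.ofReal_toReal hω.ne).symm)
    -- Layer-cake formula: the mean is the integral of the tail `1 - p t 1 0`.
    rw [h1, lintegral_eq_lintegral_meas_lt μ (Eventually.of_forall fun _ => ENNReal.toReal_nonneg)
      hmeasT.aemeasurable, ← TableSize.lintegral_one_sub_eq hp hQ hα₀ hα₁]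
    refine setLIntegral_congr_fun measurableSet_Ioi fun t ht => ?_
    have h2 : {ω | t < (TableSize.hittingTimeZero Z ω).toReal} =
        {ω | (TableSize.hittingTimeZero Z ω).toReal ≤ t}ᶜ := by
      ext ω
      simp
    rw [h2, ← hcdfT t (le_of_lt ht),
      ← probReal_compl_eq_one_sub (measurableSet_le hmeasT measurable_const), ofReal_measureReal]
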